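/- Let $G$ be a finite abelian group (written additively), let $g_0\in G$, $g_0\neq 0$, and put $G^+=G\setminus\{0\}$. The master corner polyhedron $P(G,g_0)\subset\mathbb{R}^{G^+}$ is the convex hull of all non-negative integer points $t=(t(g))_{g\in G^+}$ with $\sum_{g\in G^+}t(g)\,g=g_0$. Its graph has the vertices (extreme points) of $P(G,g_0)$ as nodes; two distinct vertices are adjacent when the segment joining them is a face (an edge) of $P(G,g_0)$. Then the graph of $P(G,g_0)$ is connected and has diameter at most $2$; the diameter is exactly $2$ unless all vertices of $P(G,g_0)$ are pairwise adjacent. Moreover, the unit point $s_0=e_{g_0}$ (with $s_0(g_0)=1$ and $s_0(g)=0$ for $g\neq g_0$) is a vertex of $P(G,g_0)$ and is adjacent to every other vertex, so that any two distinct vertices different from $s_0$ are joined by a path of length $2$ through $s_0$. -/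

import Mathlib

namespace MasterCorner

/-- The points `t = (t(g), g ∈ G⁺)` of the real coordinate space indexed by `G⁺ = G \ {0}` all of
whose coordinates are non-negative integers and which solve the group equation
`∑_{g ∈ G⁺} t(g) g = g₀`. -/
def solutions {G : Type*} [AddCommGroup G] [Fintype G] [DecidableEq G] (g₀ : G) :
    Set ({g : G // g ≠ 0} → ℝ) :=
  {t | ∃ n : {g : G // g ≠ 0} → ℕ, (∀ g, t g = (n g : ℝ)) ∧ ∑ g, n g • (g : G) = g₀}

/-- The master corner polyhedron `P(G, g₀)`: the convex hull of the non-negative integer solutions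
to the group equation. -/
def polyhedron {G : Type*} [AddCommGroup G] [Fintype G] [DecidableEq G] (g₀ : G) :
    Set ({g : G // g ≠ 0} → ℝ) :=
  convexHull ℝ (solutions g₀)

/-- The graph of a polyhedron `P`: its nodes are the vertices (extreme points) of `P`, and two
distinct vertices are adjacent when the segment joining them is a face (hence an edge) of `P`. A face of a convex set is a
convex extreme subset; unbounded edges join no two vertices and do not contribute. -/
def polyhedronGraph {ι : Type*} (P : Set (ι → ℝ)) : SimpleGraph (P.extremePoints ℝ) where
  Adj s t := s ≠ t ∧ IsExtreme ℝ P (segment ℝ (s : ι → ℝ) (t : ι → ℝ))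
  symm := ⟨fun s t h => ⟨h.1.symm, by rw [segment_symm]; exact h.2⟩⟩
  loopless := ⟨fun _ h => h.1 rfl⟩

end MasterCorner

/-!
The polyhedron `P = P(G, g₀)` is closed under adding non-negative vectors, because `N • e_g` with
`N` the order of `g` solves the homogeneous equation and can be added to any solution
(`add_mem_polyhedron`). Hence an extreme point dominates no other point of `P`
(`eq_of_le_of_mem_extremePoints`). The unit point `s₀ = e_{g₀}` is extreme since all points of `P`
have coordinate sum at least `1`, and consequently every other vertex `t`, being an integer point
that does not dominate `s₀`, vanishes at `g₀`.

A solution either vanishes at `g₀` or dominates `s₀`, so each point of `P` is, up to adding a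
non-negative vector, a convex combination `(1 - β) s₀ + β p` with `p ∈ P` and `p(g₀) = 0`
(`exists_decomposition`). Suppose an average of two such points equals `(1 - μ) s₀ + μ t`. Comparing
the coordinates at `g₀` shows that the averaged weight `β` is at least `μ`; comparing the others
shows that the weighted mean of the points `p` is at most `t`, hence equal to `t`. So `β = μ`, the
added vectors vanish, and both points lie on the segment from `s₀` to `t`, which is therefore an
edge (`isExtreme_segment_unitPoint`). The assertions about distances hold in any graph with a vertex
adjacent to all others.
-/

namespace MasterCorner

/-! ### Graphs with a vertex adjacent to all others -/

section Graph

variable {V : Type*} {Γ : SimpleGraph V} {c : V}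

theorem edist_le_two_of_forall_adj (h : ∀ v, v ≠ c → Γ.Adj c v) (u v : V) :
    Γ.edist u v ≤ 2 := by
  have key : ∀ w, Γ.edist c w ≤ 1 := fun w => by
    rw [SimpleGraph.edist_le_one_iff_adj_or_eq]
    by_cases hw : w = c
    · exact Or.inr hw.symm
    · exact Or.inl (h w hw)
  calc Γ.edist u v ≤ Γ.edist u c + Γ.edist c v := SimpleGraph.edist_triangle
    _ ≤ 1 + 1 := add_le_add (by rw [SimpleGraph.edist_comm]; exact key u) (key v)
    _ = 2 := one_add_one_eq_two

theorem connected_of_forall_adj (h : ∀ v, v ≠ c → Γ.Adj c v) : Γ.Connected := by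
  have : Nonempty V := ⟨c⟩
  refine SimpleGraph.connected_of_ediam_ne_top fun htop => ?_
  have := SimpleGraph.ediam_le_of_edist_le (edist_le_two_of_forall_adj h)
  rw [htop] at this
  exact absurd this (by decide)

theorem two_le_ediam_of_not_adj {u v : V} (huv : u ≠ v) (hadj : ¬ Γ.Adj u v) : 2 ≤ Γ.ediam := by
  refine le_trans ?_ (SimpleGraph.edist_le_ediam (u := u) (v := v))
  have h1 : 1 < Γ.edist u v := by
    rw [← not_le, SimpleGraph.edist_le_one_iff_adj_or_eq]
    exact not_or.2 ⟨hadj, huv⟩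
  rw [← one_add_one_eq_two]
  exact Order.add_one_le_of_lt h1

end Graph

/-! ### The unit point -/

variable {G : Type*} [AddCommGroup G] [DecidableEq G] {g₀ : G}

/-- The point `e_{g₀}` of the real coordinate space indexed by `G⁺`. -/
def unitPoint (hg₀ : g₀ ≠ 0) : {g : G // g ≠ 0} → ℝ := Pi.single ⟨g₀, hg₀⟩ 1

theorem unitPoint_self (hg₀ : g₀ ≠ 0) : unitPoint hg₀ ⟨g₀, hg₀⟩ = 1 := by simp [unitPoint]

theorem unitPoint_of_ne (hg₀ : g₀ ≠ 0) {g : {g : G // g ≠ 0}} (hg : g ≠ ⟨g₀, hg₀⟩) :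
    unitPoint hg₀ g = 0 := by simp [unitPoint, hg]

/-! ### Recession directions of the polyhedron -/

open scoped Pointwise

variable [Fintype G]

theorem add_mem_solutions {s z : {g : G // g ≠ 0} → ℝ}
    (hs : s ∈ solutions g₀) (hz : z ∈ solutions (0 : G)) : s + z ∈ solutions g₀ := by
  obtain ⟨n, hn, hn'⟩ := hs
  obtain ⟨m, hm, hm'⟩ := hz
  refine ⟨n + m, fun g => by simp [hn, hm], ?_⟩
  simp [add_smul, Finset.sum_add_distrib, hn', hm']

theorem add_mem_polyhedron_of_mem_polyhedron_zero {x z : {g : G // g ≠ 0} → ℝ}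
    (hx : x ∈ polyhedron g₀) (hz : z ∈ polyhedron (0 : G)) : x + z ∈ polyhedron g₀ := by
  have h : x + z ∈ convexHull ℝ (solutions g₀ + solutions (0 : G)) := by
    rw [convexHull_add]
    exact Set.add_mem_add hx hz
  refine convexHull_mono ?_ h
  rintro _ ⟨s, hs, z, hz, rfl⟩
  exact add_mem_solutions hs hz

theorem zero_mem_polyhedron_zero : (0 : {g : G // g ≠ 0} → ℝ) ∈ polyhedron (0 : G) :=
  subset_convexHull ℝ _ ⟨0, by simp, by simp⟩

theorem single_mem_polyhedron_zero (g : {g : G // g ≠ 0}) {c : ℝ} (hc : 0 ≤ c) :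
    (Pi.single g c : {g : G // g ≠ 0} → ℝ) ∈ polyhedron (0 : G) := by
  set N : ℕ := addOrderOf (g : G)
  have hN : (1 : ℝ) ≤ N := by exact_mod_cast addOrderOf_pos (g : G)
  obtain ⟨k, hk⟩ := exists_nat_gt c
  have hkpos : (0 : ℝ) < k := hc.trans_lt hk
  have hM : (Pi.single g ((k * N : ℕ) : ℝ) : {g : G // g ≠ 0} → ℝ) ∈ polyhedron (0 : G) := by
    refine subset_convexHull ℝ _ ⟨Pi.single g (k * N), fun h => ?_, ?_⟩
    · by_cases hh : h = g
      · subst hh; simp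
      · simp [hh]
    · rw [Finset.sum_eq_single g (fun b _ hb => by simp [hb]) (by simp)]
      simp [mul_smul, N, addOrderOf_nsmul_eq_zero]
  have hMpos : (0 : ℝ) < ((k * N : ℕ) : ℝ) := by push_cast; positivity
  have hle : c ≤ ((k * N : ℕ) : ℝ) := by push_cast; nlinarith
  have := (convex_convexHull ℝ (solutions (0 : G))).smul_mem_of_zero_mem
    zero_mem_polyhedron_zero hM
    (t := c / ((k * N : ℕ) : ℝ)) ⟨by positivity, (div_le_one hMpos).2 hle⟩
  rwa [← Pi.single_smul, smul_eq_mul, div_mul_cancel₀ _ hMpos.ne'] at this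

theorem mem_polyhedron_zero_of_nonneg {q : {g : G // g ≠ 0} → ℝ} (hq : 0 ≤ q) :
    q ∈ polyhedron (0 : G) := by
  rw [← Finset.univ_sum_single q]
  exact Finset.sum_induction _ (· ∈ polyhedron (0 : G))
    (fun _ _ => add_mem_polyhedron_of_mem_polyhedron_zero) zero_mem_polyhedron_zero
    fun g _ => single_mem_polyhedron_zero g (hq g)

/-- `P(G, g₀)` is closed under adding non-negative vectors. -/
theorem add_mem_polyhedron {x q : {g : G // g ≠ 0} → ℝ} (hx : x ∈ polyhedron g₀) (hq : 0 ≤ q) :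
    x + q ∈ polyhedron g₀ :=
  add_mem_polyhedron_of_mem_polyhedron_zero hx (mem_polyhedron_zero_of_nonneg hq)

theorem convex_polyhedron : Convex ℝ (polyhedron g₀) := convex_convexHull ℝ _

/-- A vertex dominates no other point `p` of the polyhedron: it is the midpoint of `p` and the
reflection of `p` in it, which is again a point of the polyhedron. -/
theorem eq_of_le_of_mem_extremePoints {t p : {g : G // g ≠ 0} → ℝ}
    (ht : t ∈ (polyhedron g₀).extremePoints ℝ) (hp : p ∈ polyhedron g₀) (hpt : p ≤ t) : p = t := by
  have hq : (0 : {g : G // g ≠ 0} → ℝ) ≤ (2 : ℝ) • (t - p) :=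
    smul_nonneg zero_le_two (sub_nonneg.2 hpt)
  refine ht.2 hp (add_mem_polyhedron hp hq) ⟨1 / 2, 1 / 2, by norm_num, by norm_num, by norm_num, ?_⟩
  ext g
  simp
  ring

/-! ### Coordinates of points of the polyhedron -/

theorem nonneg_of_mem_polyhedron {x : {g : G // g ≠ 0} → ℝ} (hx : x ∈ polyhedron g₀) : 0 ≤ x := by
  refine convexHull_min (t := Set.Ici 0) ?_ (convex_Ici _) hx
  rintro t ⟨n, hn, -⟩ g
  simp [hn]

theorem one_le_sum_of_mem_polyhedron (hg₀ : g₀ ≠ 0) {x : {g : G // g ≠ 0} → ℝ}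
    (hx : x ∈ polyhedron g₀) : 1 ≤ ∑ g, x g := by
  refine convexHull_min (t := {x : {g : G // g ≠ 0} → ℝ | 1 ≤ ∑ g, x g}) ?_ ?_ hx
  · rintro t ⟨n, hn, hsum⟩
    have : ∑ g, n g ≠ 0 := fun h0 => hg₀ <| by
      rw [← hsum]
      exact Finset.sum_eq_zero fun g hg => by rw [Finset.sum_eq_zero_iff.1 h0 g hg, zero_smul]
    simp only [Set.mem_ofPred_eq, hn]
    exact_mod_cast Nat.one_le_iff_ne_zero.2 this
  · refine convex_halfSpace_ge (f := fun x : {g : G // g ≠ 0} → ℝ => ∑ g, x g)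
      ⟨fun x y => ?_, fun c x => ?_⟩ 1
    · simp [Finset.sum_add_distrib]
    · simp [Finset.mul_sum]

/-! ### The unit point as a vertex -/

theorem unitPoint_mem_polyhedron (hg₀ : g₀ ≠ 0) : unitPoint hg₀ ∈ polyhedron g₀ := by
  refine subset_convexHull ℝ _ ⟨Pi.single ⟨g₀, hg₀⟩ 1, fun g => ?_, ?_⟩
  · by_cases hg : g = ⟨g₀, hg₀⟩
    · subst hg; simp [unitPoint]
    · simp [unitPoint, hg]
  · rw [Finset.sum_eq_single ⟨g₀, hg₀⟩ (fun b _ hb => by simp [hb]) (by simp)]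
    simp

theorem one_le_apply_of_support (hg₀ : g₀ ≠ 0) {x : {g : G // g ≠ 0} → ℝ}
    (hx : x ∈ polyhedron g₀) (h0 : ∀ g, g ≠ ⟨g₀, hg₀⟩ → x g = 0) : 1 ≤ x ⟨g₀, hg₀⟩ := by
  have := one_le_sum_of_mem_polyhedron hg₀ hx
  rwa [Finset.sum_eq_single ⟨g₀, hg₀⟩ (fun b _ hb => h0 b hb) (by simp)] at this

theorem unitPoint_mem_extremePoints (hg₀ : g₀ ≠ 0) :
    unitPoint hg₀ ∈ (polyhedron g₀).extremePoints ℝ := by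
  refine ⟨unitPoint_mem_polyhedron hg₀, ?_⟩
  rintro y hy z hz ⟨a, b, ha, hb, hab, h⟩
  have hcoord : ∀ g, a * y g + b * z g = unitPoint hg₀ g := fun g => by simp [← h]
  have hy0 := nonneg_of_mem_polyhedron hy
  have hz0 := nonneg_of_mem_polyhedron hz
  have hvanish : ∀ g, g ≠ ⟨g₀, hg₀⟩ → y g = 0 ∧ z g = 0 := fun g hg => by
    have hc := hcoord g
    rw [unitPoint_of_ne hg₀ hg] at hc
    have h1 := mul_nonneg ha.le (hy0 g)
    have h2 := mul_nonneg hb.le (hz0 g)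
    exact ⟨(mul_eq_zero.1 (by linarith : a * y g = 0)).resolve_left ha.ne',
      (mul_eq_zero.1 (by linarith : b * z g = 0)).resolve_left hb.ne'⟩
  have hy1 := one_le_apply_of_support hg₀ hy fun g hg => (hvanish g hg).1
  have hz1 := one_le_apply_of_support hg₀ hz fun g hg => (hvanish g hg).2
  ext g
  by_cases hg : g = ⟨g₀, hg₀⟩
  · subst hg
    have hc := hcoord ⟨g₀, hg₀⟩
    rw [unitPoint_self] at hc ⊢
    nlinarith
  · rw [(hvanish g hg).1, unitPoint_of_ne hg₀ hg]

theorem unitPoint_le_of_mem_solutions (hg₀ : g₀ ≠ 0) {u : {g : G // g ≠ 0} → ℝ}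
    (hu : u ∈ solutions g₀) (h : u ⟨g₀, hg₀⟩ ≠ 0) : unitPoint hg₀ ≤ u := by
  intro g
  by_cases hg : g = ⟨g₀, hg₀⟩
  · subst hg
    obtain ⟨n, hn, -⟩ := hu
    rw [hn] at h
    rw [unitPoint_self, hn, Nat.one_le_cast]
    exact Nat.one_le_iff_ne_zero.2 (by exact_mod_cast h)
  · rw [unitPoint_of_ne hg₀ hg]
    exact nonneg_of_mem_polyhedron (subset_convexHull ℝ _ hu) g

theorem apply_eq_zero_of_mem_extremePoints (hg₀ : g₀ ≠ 0) {t : {g : G // g ≠ 0} → ℝ}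
    (ht : t ∈ (polyhedron g₀).extremePoints ℝ) (hne : t ≠ unitPoint hg₀) : t ⟨g₀, hg₀⟩ = 0 := by
  by_contra h
  exact hne (eq_of_le_of_mem_extremePoints ht (unitPoint_mem_polyhedron hg₀)
    (unitPoint_le_of_mem_solutions hg₀ (extremePoints_convexHull_subset ht) h)).symm

/-! ### Edges at the unit point -/

/-- If `P(G, g₀)` has a point vanishing at `g₀`, then each of its points dominates a point of a
segment from `e_{g₀}` to a point of `P(G, g₀)` vanishing at `g₀`. -/
theorem exists_decomposition (hg₀ : g₀ ≠ 0) {t : {g : G // g ≠ 0} → ℝ}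
    (ht : t ∈ polyhedron g₀) (ht0 : t ⟨g₀, hg₀⟩ = 0) {y : {g : G // g ≠ 0} → ℝ}
    (hy : y ∈ polyhedron g₀) :
    ∃ p ∈ polyhedron g₀, p ⟨g₀, hg₀⟩ = 0 ∧ ∃ β : ℝ, 0 ≤ β ∧ β ≤ 1 ∧ ∃ q, 0 ≤ q ∧
      y = (1 - β) • unitPoint hg₀ + β • p + q := by
  set A : Set ({g : G // g ≠ 0} → ℝ) := polyhedron g₀ ∩ {x | x ⟨g₀, hg₀⟩ = 0}
  have hAconv : Convex ℝ A := convex_polyhedron.inter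
    (convex_hyperplane (f := fun x : {g : G // g ≠ 0} → ℝ => x ⟨g₀, hg₀⟩)
      ⟨fun _ _ => rfl, fun _ _ => rfl⟩ 0)
  have hconv : Convex ℝ (convexJoin ℝ {unitPoint hg₀} A + Set.Ici 0) :=
    ((convex_singleton _).convexJoin hAconv).add (convex_Ici _)
  have hsub : solutions g₀ ⊆ convexJoin ℝ {unitPoint hg₀} A + Set.Ici 0 := by
    intro u hu
    by_cases h : u ⟨g₀, hg₀⟩ = 0
    · exact ⟨u, mem_convexJoin.2 ⟨_, rfl, u, ⟨subset_convexHull ℝ _ hu, h⟩,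
        right_mem_segment ℝ _ _⟩, 0, Set.self_mem_Ici, add_zero u⟩
    · exact ⟨unitPoint hg₀, mem_convexJoin.2 ⟨_, rfl, t, ⟨ht, ht0⟩, left_mem_segment ℝ _ _⟩,
        u - unitPoint hg₀, sub_nonneg.2 (unitPoint_le_of_mem_solutions hg₀ hu h),
        add_sub_cancel _ _⟩
  obtain ⟨w, hw, q, hq, rfl⟩ := convexHull_min hsub hconv hy
  obtain ⟨_, rfl, p, hp, α, β, hα, hβ, hαβ, rfl⟩ := mem_convexJoin.1 hw
  exact ⟨p, hp.1, hp.2, β, hβ, by linarith, q, hq, by rw [← hαβ, add_sub_cancel_right]⟩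

theorem isExtreme_segment_unitPoint (hg₀ : g₀ ≠ 0) {t : {g : G // g ≠ 0} → ℝ}
    (ht : t ∈ (polyhedron g₀).extremePoints ℝ) (hne : t ≠ unitPoint hg₀) :
    IsExtreme ℝ (polyhedron g₀) (segment ℝ (unitPoint hg₀) t) := by
  have ht0 := apply_eq_zero_of_mem_extremePoints hg₀ ht hne
  refine ⟨convex_polyhedron.segment_subset (unitPoint_mem_polyhedron hg₀) ht.1, ?_⟩
  rintro y hy z hz _ ⟨ν, μ, -, hμ, hνμ, rfl⟩ hx
  obtain rfl : ν = 1 - μ := by linarith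
  rcases hμ.eq_or_lt with rfl | hμpos
  · rw [sub_zero, one_smul, zero_smul, add_zero] at hx
    rw [(unitPoint_mem_extremePoints hg₀).2 hy hz hx]
    exact left_mem_segment ℝ _ _
  obtain ⟨a, b, ha, hb, hab, h⟩ := hx
  obtain ⟨p₁, hp₁, hp₁0, β₁, hβ₁, hβ₁le, q₁, hq₁, rfl⟩ := exists_decomposition hg₀ ht.1 ht0 hy
  obtain ⟨p₂, hp₂, hp₂0, β₂, hβ₂, -, q₂, hq₂, rfl⟩ := exists_decomposition hg₀ ht.1 ht0 hz
  have hcoord : ∀ g, a * β₁ * p₁ g + b * β₂ * p₂ g + (a * q₁ g + b * q₂ g) =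
      μ * t g + (a * β₁ + b * β₂ - μ) * unitPoint hg₀ g := fun g => by
    have := congrFun h g
    simp only [Pi.add_apply, Pi.smul_apply, smul_eq_mul] at this
    linear_combination this - unitPoint hg₀ g * hab
  set β := a * β₁ + b * β₂ with hβ
  have hq : ∀ g, 0 ≤ a * q₁ g + b * q₂ g := fun g =>
    add_nonneg (mul_nonneg ha.le (hq₁ g)) (mul_nonneg hb.le (hq₂ g))
  have hμβ : μ ≤ β := by
    have hc := hcoord ⟨g₀, hg₀⟩
    rw [unitPoint_self, ht0, hp₁0, hp₂0] at hc
    linarith [hq ⟨g₀, hg₀⟩]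
  have hβpos : 0 < β := hμpos.trans_le hμβ
  have hw₁ : 0 ≤ a * β₁ / β := by positivity
  have hw₂ : 0 ≤ b * β₂ / β := by positivity
  have hw : a * β₁ / β + b * β₂ / β = 1 := by rw [← add_div, ← hβ, div_self hβpos.ne']
  have hmean : (a * β₁ / β) • p₁ + (b * β₂ / β) • p₂ = t := by
    refine eq_of_le_of_mem_extremePoints ht (convex_polyhedron hp₁ hp₂ hw₁ hw₂ hw) fun g => ?_
    have hscale : (a * β₁ / β) * p₁ g + (b * β₂ / β) * p₂ g =
        (a * β₁ * p₁ g + b * β₂ * p₂ g) / β := by ring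
    simp only [Pi.add_apply, Pi.smul_apply, smul_eq_mul]
    rw [hscale, div_le_iff₀ hβpos]
    by_cases hg : g = ⟨g₀, hg₀⟩
    · subst hg
      simp [hp₁0, hp₂0, ht0]
    · have hc := hcoord g
      rw [unitPoint_of_ne hg₀ hg] at hc
      have htg := nonneg_of_mem_polyhedron ht.1 g
      nlinarith [hq g, mul_le_mul_of_nonneg_right hμβ htg]
  have hmean' : ∀ g, a * β₁ * p₁ g + b * β₂ * p₂ g = β * t g := fun g => by
    rw [← hmean]
    simp only [Pi.add_apply, Pi.smul_apply, smul_eq_mul]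
    field_simp
  -- `t` is nonzero and vanishes at `g₀`, so some other coordinate of it forces `β ≤ μ`.
  obtain ⟨g₁, hg₁⟩ : ∃ g, 0 < t g := by
    by_contra! hle
    have := one_le_sum_of_mem_polyhedron hg₀ ht.1
    linarith [Finset.sum_nonpos fun g (_ : g ∈ Finset.univ) => hle g]
  have hβμ : β = μ := by
    have hg₁' : g₁ ≠ ⟨g₀, hg₀⟩ := by
      rintro rfl
      exact hg₁.ne' ht0
    have hc := hcoord g₁
    rw [unitPoint_of_ne hg₀ hg₁', hmean'] at hc
    refine le_antisymm (le_of_mul_le_mul_right ?_ hg₁) hμβ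
    linarith [hq g₁]
  have hq₁0 : q₁ = 0 := by
    ext g
    have hc := hcoord g
    rw [hmean', hβμ] at hc
    have h1 := mul_nonneg ha.le (hq₁ g)
    have h2 := mul_nonneg hb.le (hq₂ g)
    exact (mul_eq_zero.1 (by linarith : a * q₁ g = 0)).resolve_left ha.ne'
  rw [hq₁0, add_zero]
  rcases hβ₁.eq_or_lt with rfl | hβ₁pos
  · rw [sub_zero, one_smul, zero_smul, add_zero]
    exact left_mem_segment ℝ _ _
  have hp₁t : p₁ = t := by
    rcases hβ₂.eq_or_lt with rfl | hβ₂pos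
    · rw [mul_zero, zero_div, add_zero] at hw
      rwa [hw, mul_zero, zero_div, one_smul, zero_smul, add_zero] at hmean
    · exact ht.2 hp₁ hp₂ ⟨_, _, by positivity, by positivity, hw, hmean⟩
  rw [hp₁t]
  exact ⟨1 - β₁, β₁, sub_nonneg.2 hβ₁le, hβ₁, sub_add_cancel 1 β₁, rfl⟩

end MasterCorner

theorem theorem7 {G : Type*} [AddCommGroup G] [Fintype G] [DecidableEq G]
    (g₀ : G) (hg₀ : g₀ ≠ 0) :
    (MasterCorner.polyhedronGraph (MasterCorner.polyhedron g₀)).Connected ∧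
    (MasterCorner.polyhedronGraph (MasterCorner.polyhedron g₀)).ediam ≤ 2 ∧
    ((∃ s t : (MasterCorner.polyhedron g₀).extremePoints ℝ, s ≠ t ∧
        ¬ (MasterCorner.polyhedronGraph (MasterCorner.polyhedron g₀)).Adj s t) →
      (MasterCorner.polyhedronGraph (MasterCorner.polyhedron g₀)).ediam = 2) ∧
    ∃ s₀ : (MasterCorner.polyhedron g₀).extremePoints ℝ,
      (s₀ : {g : G // g ≠ 0} → ℝ) = Pi.single ⟨g₀, hg₀⟩ 1 ∧
      (∀ t : (MasterCorner.polyhedron g₀).extremePoints ℝ, t ≠ s₀ →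
        (MasterCorner.polyhedronGraph (MasterCorner.polyhedron g₀)).Adj s₀ t) ∧
      (∀ s t : (MasterCorner.polyhedron g₀).extremePoints ℝ, s ≠ s₀ → t ≠ s₀ → s ≠ t →
        ∃ p : (MasterCorner.polyhedronGraph (MasterCorner.polyhedron g₀)).Walk s t,
          p.IsPath ∧ p.length = 2 ∧ s₀ ∈ p.support) := by
  have hadj : ∀ t : (MasterCorner.polyhedron g₀).extremePoints ℝ,
      t ≠ ⟨_, MasterCorner.unitPoint_mem_extremePoints hg₀⟩ →
      (MasterCorner.polyhedronGraph (MasterCorner.polyhedron g₀)).Adj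
        ⟨_, MasterCorner.unitPoint_mem_extremePoints hg₀⟩ t := fun t ht =>
    ⟨ht.symm, MasterCorner.isExtreme_segment_unitPoint hg₀ t.2 fun h => ht (Subtype.ext h)⟩
  have hdiam := SimpleGraph.ediam_le_of_edist_le (MasterCorner.edist_le_two_of_forall_adj hadj)
  refine ⟨MasterCorner.connected_of_forall_adj hadj, hdiam, ?_,
    ⟨_, MasterCorner.unitPoint_mem_extremePoints hg₀⟩, rfl, hadj, ?_⟩
  · rintro ⟨s, t, hst, hnadj⟩
    exact hdiam.antisymm (MasterCorner.two_le_ediam_of_not_adj hst hnadj)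
  · intro s t hs ht hst
    refine ⟨.cons (hadj s hs).symm (.cons (hadj t ht) .nil), ?_, rfl, by simp⟩
    simp [SimpleGraph.Walk.isPath_def, hs, hst, ht.symm]
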